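/- Let $K$ be a field, $n\ge 1$, $S=K[x_1,\dots,x_n]$ and $\mathfrak m=(x_1,\dots,x_n)$. Let $I\subset S$ be a monomial ideal. Denote by $G(J)$ the unique minimal set of monomial generators of a monomial ideal $J$, and by $\operatorname{supp}(I)$ the set of all $i$ such that $x_i$ divides some $u\in G(I)$. Let $$\cdots\to F_i=\bigoplus_{j=1}^{\beta_i}S(-\mathbf a_{i,j})\to\cdots\to F_0=\bigoplus_{j=1}^{\beta_0}S(-\mathbf a_{0,j})\to I\to 0,\qquad \mathbf a_{i,j}\in\mathbb Z_{\ge0}^n,$$ be a minimal multigraded free resolution of $I$ (it is unique up to isomorphism). The $i$-th homological shift ideal of $I$ is the ideal $\operatorname{HS}_i(I)=(\mathbf x^{\mathbf a_{i,j}} : j=1,\dots,\beta_i)$. The ideal $I$ has a $d$-linear resolution if every shift $\mathbf a_{i,j}$ has total degree $d+i$; in this case the socle ideal $\operatorname{soc}(I)$ of $I$ is the monomial ideal generated by all monomials of degree $d-1$ in $G(I:\mathfrak m)$. Suppose that $I$ has a $d$-linear resolution for some $d$ and that $\operatorname{supp}(I)=\{1,\dots,n\}$. Then $$\operatorname{HS}_{n-1}(I)=x_1x_2\cdots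 x_n\cdot\operatorname{soc}(I).$$ -/

import Mathlib

namespace MonomialRes

noncomputable section

/-- The polynomial ring `S = K[x_1, …, x_n]`. -/
abbrev S (K : Type*) [Field K] (n : ℕ) : Type _ := MvPolynomial (Fin n) K

/-- The monomial `x^a`. -/
def mono (K : Type*) [Field K] {n : ℕ} (a : Fin n →₀ ℕ) : S K n :=
  MvPolynomial.monomial a 1

/-- The ideal generated by the monomials whose exponent vectors lie in `A`. -/
def monoSpan (K : Type*) [Field K] {n : ℕ} (A : Set (Fin n →₀ ℕ)) : Ideal (S K n) :=
  Ideal.span (mono K '' A)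

/-- `I` is a monomial ideal: it is generated by a set of monomials. -/
def IsMonomialIdeal {K : Type*} [Field K] {n : ℕ} (I : Ideal (S K n)) : Prop :=
  ∃ A : Set (Fin n →₀ ℕ), I = monoSpan K A

/-- `G(I)`: the exponent vectors of the monomials in `I` that are minimal with respect to
divisibility, that is, of the minimal monomial generators of `I`. -/
def minGens {K : Type*} [Field K] {n : ℕ} (I : Ideal (S K n)) : Set (Fin n →₀ ℕ) :=
  {a | Minimal (fun b : Fin n →₀ ℕ => mono K b ∈ I) a}

/-- `supp(I)`: the indices `i` such that `x_i` divides some minimal monomial generator of `I`. -/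
def supp {K : Type*} [Field K] {n : ℕ} (I : Ideal (S K n)) : Set (Fin n) :=
  {i | ∃ u ∈ minGens I, u i ≠ 0}

/-- The ideal `𝔪 = (x_1, …, x_n)`. -/
def maxIdeal (K : Type*) [Field K] (n : ℕ) : Ideal (S K n) :=
  Ideal.span (Set.range MvPolynomial.X)

/-- The socle ideal of an ideal `I` with `d`-linear resolution: the monomial ideal generated by
the minimal monomial generators of degree `d - 1` of the colon ideal `I : 𝔪`. -/
def soc {K : Type*} [Field K] {n : ℕ} (d : ℕ) (I : Ideal (S K n)) : Ideal (S K n) :=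
  monoSpan K {b | b ∈ minGens (Submodule.colon I (maxIdeal K n : Set (S K n))) ∧ b.degree + 1 = d}

/-- A minimal multigraded free resolution
`⋯ → F_2 → F_1 → F_0 → I → 0`, `F_i = ⨁_j S(-a_{i,j})`, of the ideal `I` of `S`.
As an `S`-module, `F_i` is `S ^ (β i)`, and its `j`-th standard basis vector is placed
in multidegree `shift i j = a_{i,j}`. -/
structure MinimalResolution {K : Type*} [Field K] {n : ℕ} (I : Ideal (S K n)) where
  /-- The ranks of the free modules. -/
  β : ℕ → ℕ
  /-- The multigraded shifts. -/
  shift : (i : ℕ) → Fin (β i) → (Fin n →₀ ℕ)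
  /-- The augmentation `F_0 → I ⊆ S`. -/
  aug : (Fin (β 0) → S K n) →ₗ[S K n] S K n
  /-- The differential `F_{i+1} → F_i`. -/
  diff : (i : ℕ) → (Fin (β (i + 1)) → S K n) →ₗ[S K n] (Fin (β i) → S K n)
  /-- The augmentation preserves multidegrees: a basis vector of multidegree `a` goes to
  a scalar multiple of `x^a`. -/
  aug_multigraded : ∀ j, ∃ c : K, aug (Pi.single j 1) = MvPolynomial.monomial (shift 0 j) c
  /-- The differentials preserve multidegrees: the `k`-th coordinate of the image of a basis
  vector of multidegree `a` is a scalar multiple of `x^a / x^{a_{i,k}}` (and zero if this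
  is not a monomial). -/
  diff_multigraded : ∀ i j k, ∃ c : K,
    mono K (shift i k) * diff i (Pi.single j 1) k = MvPolynomial.monomial (shift (i + 1) j) c
  /-- The image of the augmentation is `I`. -/
  range_aug : LinearMap.range aug = I
  /-- Exactness at `F_0`. -/
  exact_zero : Function.Exact (diff 0) aug
  /-- Exactness at `F_{i+1}`. -/
  exact_succ : ∀ i, Function.Exact (diff (i + 1)) (diff i)
  /-- Minimality: the image of `F_{i+1}` is contained in `𝔪 F_i`. -/
  minimal : ∀ i v k, diff i v k ∈ maxIdeal K n

/-- The resolution is `d`-linear: every basis vector of `F_i` has total degree `d + i`. -/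
def MinimalResolution.IsLinear {K : Type*} [Field K] {n : ℕ} {I : Ideal (S K n)}
    (F : MinimalResolution I) (d : ℕ) : Prop :=
  ∀ i j, (F.shift i j).degree = d + i

/-- `I` has a `d`-linear resolution. -/
def HasLinearResolution {K : Type*} [Field K] {n : ℕ} (I : Ideal (S K n)) (d : ℕ) : Prop :=
  ∃ F : MinimalResolution I, F.IsLinear d

/-- The `i`-th homological shift ideal `HS_i(I)`, generated by the monomials `x^{a_{i,j}}`, where
the `a_{i,j}` are the `i`-th multigraded shifts in the minimal multigraded free resolution
`F` of `I`. -/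
def MinimalResolution.HS {K : Type*} [Field K] {n : ℕ} {I : Ideal (S K n)}
    (F : MinimalResolution I) (i : ℕ) : Ideal (S K n) :=
  monoSpan K (Set.range (F.shift i))

end

end MonomialRes

/-!
The idea is that `Tor_n(S ⧸ I, K)` is the socle of `S ⧸ I`, shifted by `(1, …, 1)`: for every
minimal multigraded resolution of a proper ideal `I`, the shifts in homological degree `n - 1` are
the vectors `b + (1, …, 1)` with `x^b ∈ (I : 𝔪) \ I` (`MinimalResolution.range_shift_eq`). Applied
to a `d`-linear resolution this forces `b` to have degree `d - 1`; and since `I` has no monomials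
of degree below `d`, the monomials of degree `d - 1` in `(I : 𝔪)` are the same as those in
`G(I : 𝔪)` and lie outside `I`. So they generate the socle ideal (`soc_eq`), and the translation
by `(1, …, 1)` is the multiplication by `x_1 ⋯ x_n`.

Instead of comparing with the Koszul complex, the shifts are found by a direct argument in
multigraded strands. A multigraded resolution `0 ← S ← F_0 ← F_1 ← ⋯` of `S ⧸ I` amounts to a
complex of vector spaces with basis vectors labelled by multidegrees (`Frame`), whose subcomplex on
the basis vectors of multidegree `≤ a` is the strand in multidegree `a`. These strands are exact in
positive homological degrees, and their `H_0` is `K` or `0` as `x^a ∉ I` or `x^a ∈ I`. Fix `a`. For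
sets `U`, `T` of variables let `Q(U, T)` be the strand at `a - ∑ i ∈ T, e_i` modulo the sum of
the strands at `a - ∑ i ∈ T, e_i - e_s` for `s ∈ U`. By minimality, `Q(univ, ∅)` has zero
differential, so its homology in degree `n` counts the basis vectors of `F_{n-1}` of multidegree `a`
(`MinimalResolution.mem_range_augShift_iff`). The short exact sequences
`0 → Q(U, T ∪ s) → Q(U, T) → Q(U ∪ s, T) → 0` and induction on `U` give `H_i(Q(U, T)) = 0` for
`i > |U|`, and then relate `H_{|U|}(Q(U, T))` with `H_0(Q(∅, T ∪ U))`
(`Frame.not_relAcyclic_univ_iff`).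
-/

namespace MonomialRes

noncomputable section

/-! ### Scalar complexes with multigraded bases -/

/-- The scalar data of a complex of multigraded free modules: in each homological degree a finite
basis with multidegrees, and the scalar coefficients of the differentials. Multiplying the
coefficient `c i j k` by `x ^ (deg j - deg k)` recovers the matrix entry over the polynomial ring,
which explains the condition `deg_le`. -/
structure Frame (K : Type*) [Field K] (n : ℕ) where
  /-- The number of basis vectors. -/
  rank : ℕ → ℕ
  /-- The multidegrees of the basis vectors. -/
  deg : (i : ℕ) → Fin (rank i) → (Fin n →₀ ℕ)
  /-- The coefficients of the differentials. -/
  c : (i : ℕ) → Fin (rank (i + 1)) → Fin (rank i) → K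
  /-- The differentials do not raise multidegrees. -/
  deg_le : ∀ i j k, c i j k ≠ 0 → deg i k ≤ deg (i + 1) j

/-- The multidegrees `b ≤ a` with `b i < a i` for all `i ∈ T`, that is, `b ≤ a - ∑ i ∈ T, e_i`
in `ℤ ^ n`. -/
def box {n : ℕ} (a : Fin n →₀ ℕ) (T : Finset (Fin n)) : Set (Fin n →₀ ℕ) :=
  {b | b ≤ a ∧ ∀ i ∈ T, b i < a i}

/-- The union of the boxes `box a (insert i T)` for `i ∈ U`. -/
def boxBdry {n : ℕ} (a : Fin n →₀ ℕ) (U T : Finset (Fin n)) : Set (Fin n →₀ ℕ) :=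
  {b | b ∈ box a T ∧ ∃ i ∈ U, b i < a i}

section Box

variable {n : ℕ} {a : Fin n →₀ ℕ} {U T : Finset (Fin n)} {s : Fin n}

lemma isLowerSet_box : IsLowerSet (box a T) :=
  fun _ _ h hb => ⟨h.trans hb.1, fun i hi => (h i).trans_lt (hb.2 i hi)⟩

lemma isLowerSet_boxBdry : IsLowerSet (boxBdry a U T) :=
  fun _ _ h ⟨hb, i, hi, hlt⟩ => ⟨isLowerSet_box h hb, i, hi, (h i).trans_lt hlt⟩

lemma box_subset_Iic : box a T ⊆ Set.Iic a := fun _ hb => hb.1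

lemma box_insert_subset : box a (insert s T) ⊆ box a T :=
  fun _ hb => ⟨hb.1, fun i hi => hb.2 i (Finset.mem_insert_of_mem hi)⟩

lemma boxBdry_empty : boxBdry a ∅ T = ∅ := by
  ext b; simp [boxBdry]

lemma boxBdry_insert : boxBdry a (insert s U) T = boxBdry a U T ∪ box a (insert s T) := by
  ext b
  simp only [boxBdry, box, Finset.mem_insert, Set.mem_ofPred_eq, Set.mem_union,
    forall_eq_or_imp, or_and_right, exists_or, exists_eq_left]
  rw [and_or_left, or_comm]
  exact or_congr Iff.rfl (by rw [and_assoc, and_comm (b := b s < a s)])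

lemma boxBdry_inter_box : boxBdry a U T ∩ box a (insert s T) = boxBdry a U (insert s T) := by
  ext b
  simp only [boxBdry, box, Finset.mem_insert, Set.mem_ofPred_eq, Set.mem_inter_iff,
    forall_eq_or_imp]
  tauto

lemma mem_boxBdry_univ_empty {b : Fin n →₀ ℕ} :
    b ∈ boxBdry a Finset.univ ∅ ↔ b ≤ a ∧ b ≠ a := by
  simp only [boxBdry, box, Set.mem_ofPred_eq, Finset.notMem_empty, Finset.mem_univ, true_and,
    false_imp_iff, implies_true, and_true]
  refine and_congr_right fun h => ⟨?_, fun hne => ?_⟩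
  · rintro ⟨i, hi⟩ rfl
    exact lt_irrefl _ hi
  · by_contra! hcon
    exact hne (le_antisymm h hcon)

/-- A nonempty box has a largest element. -/
lemma box_eq_Iic (h : ∀ i ∈ T, a i ≠ 0) :
    box a T = Set.Iic (a - ∑ i ∈ T, Finsupp.single i 1) := by
  ext b
  have key : ∀ i, (∑ j ∈ T, Finsupp.single j 1 : Fin n →₀ ℕ) i = if i ∈ T then 1 else 0 := by
    intro i
    simp [Finsupp.finsetSum_apply, Finsupp.single_apply]
  simp only [box, Set.mem_ofPred_eq, Set.mem_Iic, Finsupp.le_def, Finsupp.tsub_apply, key]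
  refine ⟨fun hb i => ?_, fun hb => ⟨fun i => (hb i).trans (Nat.sub_le _ _), fun i hi => ?_⟩⟩
  · split_ifs with hi
    · have := hb.2 i hi; omega
    · exact hb.1 i
  · have h1 := hb i
    have h2 := h i hi
    rw [if_pos hi] at h1
    omega

lemma box_eq_empty {i : Fin n} (hi : i ∈ T) (h : a i = 0) : box a T = ∅ := by
  ext b
  simp only [box, Set.mem_ofPred_eq, Set.mem_empty_iff_false, iff_false, not_and]
  intro _ hb
  have := hb i hi
  omega

end Box

namespace Frame

variable {K : Type*} [Field K] {n : ℕ} (C : Frame K n)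

/-- The chains in homological degree `i` that are supported on basis vectors with multidegree
in `P`. -/
def chains (i : ℕ) (P : Set (Fin n →₀ ℕ)) : Submodule K (Fin (C.rank i) → K) where
  carrier := {v | ∀ j, C.deg i j ∉ P → v j = 0}
  add_mem' hv hw j hj := by simp [hv j hj, hw j hj]
  zero_mem' _ _ := rfl
  smul_mem' r v hv j hj := by simp [hv j hj]

/-- The scalar differential. -/
def d (i : ℕ) : (Fin (C.rank (i + 1)) → K) →ₗ[K] (Fin (C.rank i) → K) :=
  Matrix.vecMulLinear (Matrix.of (C.c i))

variable {C} {i : ℕ} {P Q : Set (Fin n →₀ ℕ)} {v w : Fin (C.rank i) → K}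

lemma d_apply (i : ℕ) (v : Fin (C.rank (i + 1)) → K) (k : Fin (C.rank i)) :
    C.d i v k = ∑ j, v j * C.c i j k := rfl

lemma chains_mono (h : P ⊆ Q) : C.chains i P ≤ C.chains i Q :=
  fun _ hv j hj => hv j fun hP => hj (h hP)

lemma mem_chains_inter (hP : v ∈ C.chains i P) (hQ : v ∈ C.chains i Q) :
    v ∈ C.chains i (P ∩ Q) := by
  intro j hj
  by_cases h : C.deg i j ∈ P
  · exact hQ j fun h' => hj ⟨h, h'⟩
  · exact hP j h

lemma exists_add_of_mem_chains_union (hv : v ∈ C.chains i (P ∪ Q)) :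
    ∃ p ∈ C.chains i P, ∃ q ∈ C.chains i Q, p + q = v := by
  classical
  refine ⟨fun j => if C.deg i j ∈ P then v j else 0, fun j hj => if_neg hj,
    fun j => if C.deg i j ∈ P then 0 else v j, fun j hj => ?_, ?_⟩
  · by_cases h : C.deg i j ∈ P
    · exact if_pos h
    · exact (if_neg h).trans (hv j fun h' => h'.elim h hj)
  · ext j
    by_cases h : C.deg i j ∈ P <;> simp [h]

lemma eq_zero_of_mem_chains_empty (hv : v ∈ C.chains i ∅) : v = 0 :=
  funext fun j => hv j (Set.notMem_empty _)

lemma d_mem_chains (hP : IsLowerSet P) {v : Fin (C.rank (i + 1)) → K}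
    (hv : v ∈ C.chains (i + 1) P) : C.d i v ∈ C.chains i P := by
  intro k hk
  rw [d_apply]
  refine Finset.sum_eq_zero fun j _ => ?_
  by_cases hc : C.c i j k = 0
  · simp [hc]
  · rw [hv j fun h => hk (hP (C.deg_le i j k hc) h), zero_mul]

variable (C)

/-- The `i`-th homology of the quotient `Q(U, T)` of the strand on `box a T` by the strand on
`boxBdry a U T` vanishes. The homological position `i` refers to chains in degree `i + 1`, as the
zeroth module of the complexes of interest is a trailing zero. -/
def RelAcyclic (a : Fin n →₀ ℕ) (i : ℕ) (U T : Finset (Fin n)) : Prop :=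
  ∀ v ∈ C.chains (i + 1) (box a T), C.d i v ∈ C.chains i (boxBdry a U T) →
    ∃ w ∈ C.chains (i + 2) (box a T), v - C.d (i + 1) w ∈ C.chains (i + 1) (boxBdry a U T)

/-- The strands of `C` on the boxes below `a` are complexes, exact except at the end. -/
structure IsResolution (a : Fin n →₀ ℕ) : Prop where
  d_d : ∀ i, ∀ v ∈ C.chains (i + 2) (Set.Iic a), C.d i (C.d (i + 1) v) = 0
  exact : ∀ i T, ∀ v ∈ C.chains (i + 2) (box a T), C.d (i + 1) v = 0 →
    ∃ w ∈ C.chains (i + 3) (box a T), C.d (i + 2) w = v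

variable {C} {a : Fin n →₀ ℕ} {U T : Finset (Fin n)} {s : Fin n}

/-- The part `H_{i+1}(Q(U, T)) → H_{i+1}(Q(U ∪ s, T)) → H_i(Q(U, T ∪ s))` of the long exact
sequence in homology. -/
lemma RelAcyclic.insert_left (hC : C.IsResolution a) (h₁ : C.RelAcyclic a (i + 1) U T)
    (h₂ : C.RelAcyclic a i U (insert s T)) : C.RelAcyclic a (i + 1) (insert s U) T := by
  intro v hv hdv
  rw [boxBdry_insert] at hdv ⊢
  obtain ⟨p, hp, q, hq, hpq⟩ := exists_add_of_mem_chains_union hdv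
  have hdq : C.d i q ∈ C.chains i (boxBdry a U (insert s T)) := by
    rw [← boxBdry_inter_box]
    refine mem_chains_inter ?_ (d_mem_chains isLowerSet_box hq)
    have h0 : C.d i p + C.d i q = 0 := by
      rw [← map_add, hpq, hC.d_d i v (chains_mono box_subset_Iic hv)]
    rw [eq_neg_of_add_eq_zero_right h0]
    exact neg_mem (d_mem_chains isLowerSet_boxBdry hp)
  obtain ⟨w, hw, hqw⟩ := h₂ q hq hdq
  obtain ⟨u, hu, hvu⟩ := h₁ (v - w) (sub_mem hv (chains_mono box_insert_subset hw)) (by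
    rw [map_sub, ← hpq, add_sub_assoc]
    refine add_mem hp (chains_mono ?_ hqw)
    rw [← boxBdry_inter_box]
    exact Set.inter_subset_left)
  refine ⟨u, hu, ?_⟩
  have : v - C.d (i + 1 + 1) u = (v - w - C.d (i + 1 + 1) u) + w := by abel
  rw [this]
  exact add_mem (chains_mono Set.subset_union_left hvu) (chains_mono Set.subset_union_right hw)

/-- The part `H_{i+1}(Q(U ∪ s, T)) → H_i(Q(U, T ∪ s)) → H_i(Q(U, T))` of the long exact
sequence in homology. -/
lemma RelAcyclic.insert_right (hC : C.IsResolution a)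
    (h₁ : C.RelAcyclic a (i + 1) (insert s U) T) (h₂ : C.RelAcyclic a i U T) :
    C.RelAcyclic a i U (insert s T) := by
  intro v hv hdv
  have hsub : boxBdry a U (insert s T) ⊆ boxBdry a U T := by
    rw [← boxBdry_inter_box]
    exact Set.inter_subset_left
  obtain ⟨w, hw, hvw⟩ := h₂ v (chains_mono box_insert_subset hv) (chains_mono hsub hdv)
  obtain ⟨u, hu, hwu⟩ := h₁ w hw (by
    have : C.d (i + 1) w = v - (v - C.d (i + 1) w) := by abel
    rw [this, boxBdry_insert]
    exact sub_mem (chains_mono Set.subset_union_right hv) (chains_mono Set.subset_union_left hvw))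
  rw [boxBdry_insert] at hwu
  obtain ⟨p, hp, q, hq, hpq⟩ := exists_add_of_mem_chains_union hwu
  refine ⟨q, hq, ?_⟩
  rw [← boxBdry_inter_box]
  refine mem_chains_inter ?_ (sub_mem hv (d_mem_chains isLowerSet_box hq))
  have hd : C.d (i + 1) p + C.d (i + 1) q = C.d (i + 1) w := by
    rw [← map_add, hpq, map_sub, hC.d_d (i + 1) u (chains_mono box_subset_Iic hu), sub_zero]
  have : v - C.d (i + 1) q = (v - C.d (i + 1) w) + C.d (i + 1) p := by
    rw [← hd]; abel
  rw [this]
  exact add_mem hvw (d_mem_chains isLowerSet_boxBdry hp)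

/-- The homology of `Q(U, T)` vanishes in degrees above `|U|`. -/
lemma RelAcyclic.of_card_lt (hC : C.IsResolution a) :
    ∀ {i : ℕ} {T : Finset (Fin n)}, U.card < i → C.RelAcyclic a i U T := by
  induction U using Finset.induction_on with
  | empty =>
    intro i T hi
    obtain ⟨i, rfl⟩ := Nat.exists_eq_succ_of_ne_zero hi.ne'
    intro v hv hdv
    rw [boxBdry_empty] at hdv ⊢
    obtain ⟨w, hw, rfl⟩ := hC.exact i T v hv (eq_zero_of_mem_chains_empty hdv)
    exact ⟨w, hw, by simp⟩
  | insert s U hs ih =>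
    intro i T hi
    rw [Finset.card_insert_of_notMem hs] at hi
    obtain ⟨i, rfl⟩ := Nat.exists_eq_succ_of_ne_zero (Nat.ne_zero_of_lt hi)
    exact .insert_left hC (ih (by omega)) (ih (by omega))

/-- Nonvanishing homology of `Q(R ∪ U, T)` in degree `|R ∪ U|` descends to `Q(R, T ∪ U)` in
degree `|R|`, since the connecting maps are injective in these degrees. -/
lemma not_relAcyclic_of_union (hC : C.IsResolution a) {R : Finset (Fin n)} (hRS : Disjoint R U)
    (h : ¬ C.RelAcyclic a (R ∪ U).card (R ∪ U) T) : ¬ C.RelAcyclic a R.card R (T ∪ U) := by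
  induction U using Finset.induction_on generalizing T with
  | empty => simpa using h
  | insert s U hs ih =>
    rw [Finset.disjoint_insert_right] at hRS
    have hs' : s ∉ R ∪ U := by simp [hs, hRS.1]
    rw [Finset.union_insert, Finset.card_insert_of_notMem hs'] at h
    have := ih hRS.2 (T := insert s T)
      fun h' => h (.insert_left hC (.of_card_lt hC (Nat.lt_succ_self _)) h')
    rwa [Finset.union_insert, ← Finset.insert_union]

/-- If the zeroth homology of `box a T` is nonzero then, the module in degree zero having rank one,
all boundaries in the box vanish, and so `H_0` of `box a (insert s T)` maps injectively to it. -/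
lemma relAcyclic_one_singleton (hC : C.IsResolution a) (hr : C.rank 1 = 1)
    (h : ¬ C.RelAcyclic a 0 ∅ T) : C.RelAcyclic a 1 {s} T := by
  intro v hv _
  have : Subsingleton (Fin (C.rank 1)) := by rw [hr]; infer_instance
  suffices hdv : C.d 1 v = 0 by
    obtain ⟨w, hw, rfl⟩ := hC.exact 0 T v hv hdv
    exact ⟨w, hw, by simp⟩
  by_contra hne
  obtain ⟨j, hj⟩ := Function.ne_iff.mp hne
  refine h fun u _ _ => ⟨(u j / C.d 1 v j) • v, Submodule.smul_mem _ _ hv, ?_⟩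
  have hu : C.d 1 ((u j / C.d 1 v j) • v) = u := by
    ext k
    rw [Subsingleton.elim k j, map_smul, Pi.smul_apply, smul_eq_mul]
    exact div_mul_cancel₀ _ hj
  rw [hu, sub_self]
  exact zero_mem _

/-- The top homology of `Q(univ, ∅)` is nonzero exactly if the zeroth homology is nonzero at
`a - (1, …, 1)` and vanishes after one step in any coordinate direction. -/
theorem not_relAcyclic_univ_iff (hC : C.IsResolution a) (hr : C.rank 1 = 1) :
    ¬ C.RelAcyclic a n Finset.univ ∅ ↔
      ¬ C.RelAcyclic a 0 ∅ Finset.univ ∧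
        ∀ s, C.RelAcyclic a 0 ∅ (Finset.univ.erase s) := by
  refine ⟨fun h => ⟨?_, fun s => ?_⟩, fun ⟨h, h'⟩ => ?_⟩
  · have := not_relAcyclic_of_union (U := Finset.univ) (R := ∅) (T := ∅) hC (by simp)
      (by simpa using h)
    simpa using this
  · by_contra hs
    have := not_relAcyclic_of_union (U := Finset.univ.erase s) (R := {s}) (T := ∅) hC (by simp)
      (by simpa [Finset.singleton_union, Finset.insert_erase] using h)
    rw [Finset.empty_union] at this
    exact this (relAcyclic_one_singleton hC hr hs)
  · have key : ∀ U : Finset (Fin n), ¬ C.RelAcyclic a U.card U Uᶜ := by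
      intro U
      induction U using Finset.induction_on with
      | empty => simpa using h
      | insert s U hs ih =>
        intro hcon
        rw [Finset.card_insert_of_notMem hs] at hcon
        have hins : insert s (insert s U)ᶜ = Uᶜ := by
          ext t; by_cases hts : t = s <;> simp [hts, hs]
        have huni : (insert s U)ᶜ ∪ U = Finset.univ.erase s := by
          ext t
          by_cases hts : t = s
          · simp [hts, hs]
          · simp [hts, em']
        refine ih (hins ▸ RelAcyclic.insert_right hC hcon ?_)
        by_contra hS
        have := not_relAcyclic_of_union (U := U) (R := ∅) (T := (insert s U)ᶜ) hC (by simp)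
          (by rwa [Finset.empty_union])
        rw [huni] at this
        exact this (h' s)
    simpa using key Finset.univ

end Frame

/-! ### The augmented resolution and its strands -/

section Mono

variable {K : Type*} [Field K] {n : ℕ}

lemma mono_add (a b : Fin n →₀ ℕ) : mono K (a + b) = mono K a * mono K b := by
  simp [mono, MvPolynomial.monomial_mul]

lemma mono_ne_zero (a : Fin n →₀ ℕ) : mono K a ≠ 0 := by
  simp [mono]

lemma mono_single (i : Fin n) : mono K (Finsupp.single i 1) = MvPolynomial.X i := rfl

end Mono

namespace MinimalResolution

variable {K : Type*} [Field K] {n : ℕ} {I : Ideal (S K n)} (F : MinimalResolution I)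

/-- The ranks of the free modules in `0 ← S ← F_0 ← F_1 ← ⋯`. -/
def augRank : ℕ → ℕ
  | 0 => 0
  | 1 => 1
  | i + 2 => F.β i

/-- The multidegrees of the basis vectors in `0 ← S ← F_0 ← F_1 ← ⋯`. -/
def augShift : (i : ℕ) → Fin (F.augRank i) → (Fin n →₀ ℕ)
  | 0 => fun _ => 0
  | 1 => fun _ => 0
  | i + 2 => F.shift i

/-- The maps in `0 ← S ← F_0 ← F_1 ← ⋯`. -/
def augDiff : (i : ℕ) →
    (Fin (F.augRank (i + 1)) → S K n) →ₗ[S K n] (Fin (F.augRank i) → S K n)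
  | 0 => 0
  | 1 => LinearMap.pi fun _ => F.aug
  | i + 2 => F.diff i

lemma augDiff_multigraded : ∀ i j k, ∃ c : K,
    mono K (F.augShift i k) * F.augDiff i (Pi.single j 1) k =
      MvPolynomial.monomial (F.augShift (i + 1) j) c
  | 0, _, k => k.elim0
  | 1, j, _ => by
    obtain ⟨c, hc⟩ := F.aug_multigraded j
    refine ⟨c, ?_⟩
    change mono K 0 * F.aug (Pi.single j 1) = _
    rw [hc]
    exact one_mul _
  | i + 2, j, k => F.diff_multigraded i j k

lemma augDiff_exact : ∀ i, Function.Exact (F.augDiff (i + 2)) (F.augDiff (i + 1))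
  | 0 => fun y =>
    ⟨fun h => (F.exact_zero y).mp (congrFun h (0 : Fin 1)),
      fun h => funext fun _ => (F.exact_zero y).mpr h⟩
  | i + 1 => F.exact_succ i

lemma augDiff_augDiff : ∀ i v, F.augDiff i (F.augDiff (i + 1) v) = 0
  | 0, _ => rfl
  | i + 1, v => (F.augDiff_exact i).apply_apply_eq_zero v

/-- The scalar coefficients of the differentials in `0 ← S ← F_0 ← F_1 ← ⋯`. -/
def augCoeff (i : ℕ) (j : Fin (F.augRank (i + 1))) (k : Fin (F.augRank i)) : K :=
  (F.augDiff_multigraded i j k).choose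

lemma mono_mul_augDiff_single (i : ℕ) (j : Fin (F.augRank (i + 1))) (k : Fin (F.augRank i)) :
    mono K (F.augShift i k) * F.augDiff i (Pi.single j 1) k =
      MvPolynomial.monomial (F.augShift (i + 1) j) (F.augCoeff i j k) :=
  (F.augDiff_multigraded i j k).choose_spec

/-- The scalar complex of the augmented resolution. -/
abbrev frame : Frame K n where
  rank := F.augRank
  deg := F.augShift
  c := F.augCoeff
  deg_le i j k hc := by
    have h := congrArg (MvPolynomial.coeff (F.augShift (i + 1) j))
      (F.mono_mul_augDiff_single i j k)
    unfold mono at h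
    rw [MvPolynomial.coeff_monomial_mul', MvPolynomial.coeff_monomial, if_pos rfl] at h
    by_contra hle
    rw [if_neg hle] at h
    exact hc h.symm

lemma mono_mul_augDiff (i : ℕ) (f : Fin (F.augRank (i + 1)) → S K n) (k : Fin (F.augRank i)) :
    mono K (F.augShift i k) * F.augDiff i f k =
      ∑ j, MvPolynomial.C (F.augCoeff i j k) * (mono K (F.augShift (i + 1) j) * f j) := by
  classical
  conv_lhs => rw [pi_eq_sum_univ' f]
  rw [map_sum, Finset.sum_apply, Finset.mul_sum]
  refine Finset.sum_congr rfl fun j _ => ?_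
  rw [map_smul, Pi.smul_apply, smul_eq_mul, mul_left_comm]
  rw [mono_mul_augDiff_single, ← mul_assoc, mono, MvPolynomial.C_mul_monomial, mul_one, mul_comm]

/-- The component in multidegree `a` of an element of a free module of the resolution. -/
def component (a : Fin n →₀ ℕ) (i : ℕ) (f : Fin (F.augRank i) → S K n) :
    Fin (F.frame.rank i) → K :=
  fun j => MvPolynomial.coeff a (mono K (F.augShift i j) * f j)

/-- The homogeneous element of multidegree `a` with given coefficients; coordinates at basis
vectors whose multidegree does not divide `a` are dropped. -/
def homogeneous (a : Fin n →₀ ℕ) (i : ℕ) (v : Fin (F.frame.rank i) → K) :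
    Fin (F.augRank i) → S K n :=
  fun j => MvPolynomial.monomial (a - F.augShift i j) (v j)

variable {F} {a : Fin n →₀ ℕ}

lemma component_mem_chains (i : ℕ) (f : Fin (F.augRank i) → S K n) :
    F.component a i f ∈ F.frame.chains i (Set.Iic a) := by
  intro j hj
  have hj' : ¬ F.augShift i j ≤ a := hj
  rw [component, mono, MvPolynomial.coeff_monomial_mul', if_neg hj']

lemma d_component (i : ℕ) (f : Fin (F.augRank (i + 1)) → S K n) :
    F.frame.d i (F.component a (i + 1) f) = F.component a i (F.augDiff i f) := by
  ext k
  rw [Frame.d_apply, component, mono_mul_augDiff, MvPolynomial.coeff_sum]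
  refine Finset.sum_congr rfl fun j _ => ?_
  rw [MvPolynomial.coeff_C_mul, component, mul_comm]

lemma mono_mul_homogeneous {i : ℕ} {v : Fin (F.frame.rank i) → K}
    (hv : v ∈ F.frame.chains i (Set.Iic a)) (j : Fin (F.augRank i)) :
    mono K (F.augShift i j) * F.homogeneous a i v j = MvPolynomial.monomial a (v j) := by
  rw [homogeneous, mono, MvPolynomial.monomial_mul, one_mul]
  by_cases h : F.augShift i j ≤ a
  · rw [add_tsub_cancel_of_le h]
  · rw [hv j h, map_zero, map_zero]

lemma component_homogeneous {i : ℕ} {v : Fin (F.frame.rank i) → K}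
    (hv : v ∈ F.frame.chains i (Set.Iic a)) : F.component a i (F.homogeneous a i v) = v := by
  ext j
  rw [component, mono_mul_homogeneous hv, MvPolynomial.coeff_monomial, if_pos rfl]

lemma augDiff_homogeneous {i : ℕ} {v : Fin (F.frame.rank (i + 1)) → K}
    (hv : v ∈ F.frame.chains (i + 1) (Set.Iic a)) :
    F.augDiff i (F.homogeneous a (i + 1) v) = F.homogeneous a i (F.frame.d i v) := by
  ext k : 1
  refine mul_left_cancel₀ (mono_ne_zero (K := K) (F.augShift i k)) ?_
  rw [mono_mul_homogeneous (Frame.d_mem_chains (isLowerSet_Iic a) hv), mono_mul_augDiff,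
    Frame.d_apply, map_sum]
  refine Finset.sum_congr rfl fun j _ => ?_
  rw [mono_mul_homogeneous hv, MvPolynomial.C_mul_monomial, mul_comm]

lemma exists_d_eq {i : ℕ} {v : Fin (F.frame.rank (i + 2)) → K}
    (hv : v ∈ F.frame.chains (i + 2) (Set.Iic a)) (h : F.frame.d (i + 1) v = 0) :
    ∃ w ∈ F.frame.chains (i + 3) (Set.Iic a), F.frame.d (i + 2) w = v := by
  have h0 : F.augDiff (i + 1) (F.homogeneous a (i + 2) v) = 0 := by
    rw [augDiff_homogeneous hv, h]
    ext1 j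
    exact map_zero _
  obtain ⟨g, hg⟩ := (F.augDiff_exact i _).mp h0
  exact ⟨F.component a _ g, component_mem_chains _ _,
    by rw [d_component, hg, component_homogeneous hv]⟩

lemma frame_isResolution (F : MinimalResolution I) (a : Fin n →₀ ℕ) :
    F.frame.IsResolution a where
  d_d i v hv := by
    rw [← component_homogeneous hv, d_component, d_component, augDiff_augDiff]
    ext j
    change MvPolynomial.coeff a (_ * 0) = 0
    rw [mul_zero, MvPolynomial.coeff_zero]
  exact i T v hv h := by
    by_cases hT : ∀ i ∈ T, a i ≠ 0
    · rw [box_eq_Iic hT] at hv ⊢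
      exact exists_d_eq hv h
    · push Not at hT
      obtain ⟨i, hi, h0⟩ := hT
      rw [box_eq_empty hi h0] at hv
      exact ⟨0, zero_mem _, by rw [map_zero, Frame.eq_zero_of_mem_chains_empty hv]⟩

/-- The monomial of exponent `a` lies in `I` exactly if the strand in multidegree `a` surjects onto
the one-dimensional component of `S`. -/
lemma mono_mem_iff : mono K a ∈ I ↔
    ∃ w ∈ F.frame.chains 2 (Set.Iic a), F.frame.d 1 w = fun _ => 1 := by
  have hmem : ∀ x, x ∈ I ↔ ∃ f, F.aug f = x := fun x => by
    rw [← LinearMap.mem_range, F.range_aug]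
  rw [hmem]
  constructor
  · rintro ⟨f, hf⟩
    refine ⟨F.component a 2 f, component_mem_chains _ _, ?_⟩
    refine (d_component 1 f).trans ?_
    ext j
    change MvPolynomial.coeff a (mono K 0 * F.aug f) = 1
    rw [hf, ← mono_add, zero_add, mono, MvPolynomial.coeff_monomial, if_pos rfl]
  · rintro ⟨w, hw, hdw⟩
    refine ⟨F.homogeneous a 2 w, ?_⟩
    have h := congrFun (augDiff_homogeneous hw) (0 : Fin 1)
    rw [hdw] at h
    refine h.trans ?_
    change MvPolynomial.monomial (a - 0) 1 = _
    rw [tsub_zero, mono]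

/-- The zeroth homology of the strand of `S ⧸ I` on a box vanishes exactly if the box is empty or
its largest element is the exponent of a monomial in `I`. -/
lemma relAcyclic_zero_iff {T : Finset (Fin n)} : F.frame.RelAcyclic a 0 ∅ T ↔
    ((∀ i ∈ T, a i ≠ 0) → mono K (a - ∑ i ∈ T, Finsupp.single i 1) ∈ I) := by
  constructor
  · intro h hT
    rw [mono_mem_iff (F := F), ← box_eq_Iic hT]
    obtain ⟨w, hw, hdw⟩ := h (fun _ => 1)
      (by
        rw [box_eq_Iic hT]
        exact fun j hj => absurd (zero_le : (0 : Fin n →₀ ℕ) ≤ _) hj)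
      (fun j => j.elim0)
    rw [boxBdry_empty] at hdw
    exact ⟨w, hw, (sub_eq_zero.mp (Frame.eq_zero_of_mem_chains_empty hdw)).symm⟩
  · intro h v hv _
    by_cases hT : ∀ i ∈ T, a i ≠ 0
    · have h' := h hT
      rw [mono_mem_iff (F := F), ← box_eq_Iic hT] at h'
      obtain ⟨w, hw, hdw⟩ := h'
      let k : Fin (F.frame.rank 1) := (0 : Fin 1)
      refine ⟨v k • w, Submodule.smul_mem _ _ hw, ?_⟩
      have hvw : F.frame.d 1 (v k • w) = v := by
        ext j
        have hj : j = k := Subsingleton.elim (α := Fin 1) j k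
        rw [map_smul, hdw, hj, Pi.smul_apply, smul_eq_mul, mul_one]
      rw [hvw, sub_self]
      exact zero_mem _
    · push Not at hT
      obtain ⟨i, hi, h0⟩ := hT
      rw [box_eq_empty hi h0] at hv
      exact ⟨0, zero_mem _, by simp [Frame.eq_zero_of_mem_chains_empty hv]⟩

lemma coeff_zero_of_mem_maxIdeal {f : S K n} (hf : f ∈ maxIdeal K n) :
    MvPolynomial.coeff 0 f = 0 := by
  have : maxIdeal K n ≤ RingHom.ker (MvPolynomial.constantCoeff (σ := Fin n) (R := K)) := by
    rw [maxIdeal, Ideal.span_le]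
    rintro _ ⟨i, rfl⟩
    simp [RingHom.mem_ker]
  exact this hf

/-- Minimality: no coefficient of the differential connects basis vectors of equal multidegree.
For the augmentation this needs that `I` is a proper ideal. -/
lemma augShift_ne (h1 : (1 : S K n) ∉ I) : ∀ i j k, F.augCoeff i j k ≠ 0 →
    F.augShift i k ≠ F.augShift (i + 1) j
  | 0, _, k => k.elim0
  | 1, j, k => fun hc heq => by
    have h := F.mono_mul_augDiff_single 1 j k
    rw [← heq] at h
    change mono K 0 * F.aug (Pi.single j 1) = MvPolynomial.C (F.augCoeff 1 j k) at h
    have hmem : mono K 0 * F.aug (Pi.single j 1) ∈ I := by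
      refine Ideal.mul_mem_left _ _ ?_
      have := LinearMap.mem_range_self F.aug (Pi.single j 1)
      rwa [F.range_aug] at this
    rw [h] at hmem
    refine h1 ?_
    have := Ideal.mul_mem_left I (MvPolynomial.C (F.augCoeff 1 j k)⁻¹) hmem
    rwa [← MvPolynomial.C_mul, inv_mul_cancel₀ hc, MvPolynomial.C_1] at this
  | i + 2, j, k => fun hc heq => by
    have h := congrArg (MvPolynomial.coeff (F.augShift (i + 3) j))
      (F.mono_mul_augDiff_single (i + 2) j k)
    rw [mono, MvPolynomial.coeff_monomial_mul', MvPolynomial.coeff_monomial, if_pos rfl,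
      if_pos heq.le, ← heq, tsub_self, one_mul] at h
    refine hc (h.symm.trans ?_)
    exact coeff_zero_of_mem_maxIdeal (F.minimal i _ k)

lemma d_mem_chains_boxBdry (h1 : (1 : S K n) ∉ I) {i : ℕ} {v : Fin (F.frame.rank (i + 1)) → K}
    (hv : v ∈ F.frame.chains (i + 1) (box a ∅)) :
    F.frame.d i v ∈ F.frame.chains i (boxBdry a Finset.univ ∅) := by
  intro k hk
  rw [Frame.d_apply]
  refine Finset.sum_eq_zero fun j _ => ?_
  by_contra hne
  have hc := right_ne_zero_of_mul hne
  have hj : F.augShift (i + 1) j ≤ a := by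
    by_contra hle
    exact left_ne_zero_of_mul hne (hv j fun h => hle h.1)
  refine hk (mem_boxBdry_univ_empty.mpr ⟨(F.frame.deg_le i j k hc).trans hj, fun heq => ?_⟩)
  exact augShift_ne h1 i j k hc
    (le_antisymm (F.frame.deg_le i j k hc) (hj.trans_eq heq.symm))

/-- By minimality, the homology of the quotient of the strand in multidegrees `≤ a` by the strand
in multidegrees `< a` has the basis vectors of multidegree `a` as a basis. -/
lemma mem_range_augShift_iff (h1 : (1 : S K n) ∉ I) (i : ℕ) :
    a ∈ Set.range (F.augShift (i + 1)) ↔ ¬ F.frame.RelAcyclic a i Finset.univ ∅ := by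
  classical
  constructor
  · rintro ⟨j, rfl⟩ h
    have hv : (Pi.single j 1 : Fin (F.frame.rank (i + 1)) → K) ∈
        F.frame.chains (i + 1) (box (F.augShift (i + 1) j) ∅) := by
      intro k hk
      refine Pi.single_eq_of_ne ?_ _
      rintro rfl
      exact hk ⟨le_rfl, by simp⟩
    obtain ⟨w, hw, hdw⟩ := h _ hv (d_mem_chains_boxBdry h1 hv)
    have hmem := add_mem hdw (d_mem_chains_boxBdry h1 hw)
    rw [sub_add_cancel] at hmem
    have := hmem j fun hb => (mem_boxBdry_univ_empty.mp hb).2 rfl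
    rw [Pi.single_eq_same] at this
    exact one_ne_zero this
  · intro h
    by_contra ha
    refine h fun v hv _ => ⟨0, zero_mem _, ?_⟩
    rw [map_zero, sub_zero]
    intro j hj
    refine hv j fun hb => hj (mem_boxBdry_univ_empty.mpr ⟨hb.1, fun heq => ha ⟨j, heq⟩⟩)

/-! ### The last shifts and the socle -/

/-- The exponent vectors of the monomials in `(I : 𝔪)` that do not lie in `I`. -/
def _root_.MonomialRes.socleExponents (I : Ideal (S K n)) : Set (Fin n →₀ ℕ) :=
  {b | mono K b ∉ I ∧ ∀ i, mono K (b + Finsupp.single i 1) ∈ I}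

/-- The shifts in homological degree `n - 1` are the socle exponents translated by `(1, …, 1)`.
This is the isomorphism of `Tor_n(S ⧸ I, K)` with the socle of `S ⧸ I`. -/
theorem range_shift_eq (F : MinimalResolution I) (hn : 1 ≤ n) (h1 : (1 : S K n) ∉ I) :
    Set.range (F.shift (n - 1)) =
      (fun b => (∑ i, Finsupp.single i 1) + b) '' socleExponents I := by
  obtain ⟨m, rfl⟩ := Nat.exists_eq_add_of_le' hn
  have hone : ∀ i, (∑ j, Finsupp.single j 1 : Fin (m + 1) →₀ ℕ) i = 1 := by
    intro i
    simp [Finsupp.finsetSum_apply, Finsupp.single_apply]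
  ext a
  change a ∈ Set.range (F.augShift (m + 1 + 1)) ↔ _
  rw [mem_range_augShift_iff h1,
    Frame.not_relAcyclic_univ_iff (F.frame_isResolution a) rfl, relAcyclic_zero_iff]
  simp only [relAcyclic_zero_iff, Set.mem_image, socleExponents, Set.mem_ofPred_eq]
  have hsplit : ∀ s : Fin (m + 1), (∑ j, Finsupp.single j 1 : Fin (m + 1) →₀ ℕ) =
      (∑ j ∈ Finset.univ.erase s, Finsupp.single j 1) + Finsupp.single s 1 :=
    fun s => (Finset.sum_erase_add _ _ (Finset.mem_univ s)).symm
  constructor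
  · rintro ⟨h, h'⟩
    push Not at h
    have hle : (∑ j, Finsupp.single j 1 : Fin (m + 1) →₀ ℕ) ≤ a := fun i => by
      rw [hone]
      exact Nat.one_le_iff_ne_zero.mpr (h.1 i (Finset.mem_univ i))
    refine ⟨a - ∑ j, Finsupp.single j 1, ⟨h.2, fun s => ?_⟩, add_tsub_cancel_of_le hle⟩
    have := h' s fun i _ => h.1 i (Finset.mem_univ i)
    convert this using 2
    rw [hsplit s] at hle ⊢
    rw [← tsub_tsub, tsub_add_cancel_of_le (le_tsub_of_add_le_left hle)]
  · rintro ⟨b, ⟨hb, hb'⟩, rfl⟩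
    refine ⟨fun h => hb ?_, fun s _ => ?_⟩
    · have := h fun i _ => by simp
      rwa [add_tsub_cancel_left] at this
    · rw [hsplit s, add_assoc, add_tsub_cancel_left, add_comm (Finsupp.single s 1)]
      exact hb' s

lemma IsLinear.le_degree {d : ℕ} (hF : F.IsLinear d) (h : mono K a ∈ I) : d ≤ a.degree := by
  obtain ⟨w, hw, hdw⟩ := (mono_mem_iff (F := F)).mp h
  by_contra hlt
  have hw0 : w = 0 := by
    ext j
    refine hw j fun hj => hlt ?_
    have h0 : (F.shift 0 j).degree = d + 0 := hF 0 j
    have := Finsupp.degree_mono (show F.shift 0 j ≤ a from hj)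
    omega
  rw [hw0, map_zero] at hdw
  exact zero_ne_one (congrFun hdw (0 : Fin 1))

end MinimalResolution

section Socle

variable {K : Type*} [Field K] {n : ℕ} {I : Ideal (S K n)}

lemma mono_mem_colon_iff {b : Fin n →₀ ℕ} :
    mono K b ∈ Submodule.colon I (maxIdeal K n : Set (S K n)) ↔
      ∀ i, mono K (b + Finsupp.single i 1) ∈ I := by
  rw [Submodule.mem_colon]
  constructor
  · intro h i
    rw [mono_add, mono_single]
    exact h _ (Ideal.subset_span ⟨i, rfl⟩)
  · intro h p hp
    have : maxIdeal K n ≤ Submodule.comap (LinearMap.mulLeft (S K n) (mono K b)) I := by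
      rw [maxIdeal, Ideal.span_le]
      rintro _ ⟨i, rfl⟩
      have := h i
      rwa [mono_add, mono_single] at this
    exact this hp

/-- For an ideal with `d`-linear resolution, all monomials in `(I : 𝔪)` outside `I` have degree
`d - 1`, as their translates are shifts in homological degree `n - 1`; and the monomials of degree
`d - 1` in `(I : 𝔪)` are automatically minimal and outside `I`, since `I` starts in degree `d`. -/
lemma soc_eq {d : ℕ} (hn : 1 ≤ n) (h1 : (1 : S K n) ∉ I) (hlin : HasLinearResolution I d) :
    soc d I = monoSpan K (socleExponents I) := by
  obtain ⟨F, hF⟩ := hlin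
  have hdeg : (∑ i, Finsupp.single i 1 : Fin n →₀ ℕ).degree = n := by
    simp [map_sum]
  rw [soc]
  congr 1
  ext b
  simp only [Set.mem_ofPred_eq, minGens, mono_mem_colon_iff, socleExponents]
  constructor
  · rintro ⟨hb, hd⟩
    exact ⟨fun hbI => absurd (hF.le_degree hbI) (by omega), hb.prop⟩
  · rintro ⟨hb, hb'⟩
    have hd : b.degree + 1 = d := by
      have hmem : (∑ i, Finsupp.single i 1) + b ∈ Set.range (F.shift (n - 1)) := by
        rw [F.range_shift_eq hn h1]
        exact ⟨b, ⟨hb, hb'⟩, rfl⟩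
      obtain ⟨j, hj⟩ := hmem
      have := hF (n - 1) j
      rw [hj, map_add, hdeg] at this
      omega
    refine ⟨⟨hb', fun c hc hcb => ?_⟩, hd⟩
    have hcd := hF.le_degree (hc ⟨0, hn⟩)
    rw [map_add, Finsupp.degree_single] at hcd
    obtain ⟨e, rfl⟩ := exists_add_of_le hcb
    rw [map_add] at hd
    have he : e = 0 := (Finsupp.degree_eq_zero_iff e).mp (by omega)
    simp [he]

lemma one_notMem_of_supp (hn : 1 ≤ n) (hsupp : supp I = Set.univ) : (1 : S K n) ∉ I := by
  intro h1
  obtain ⟨u, hu, hne⟩ : (⟨0, hn⟩ : Fin n) ∈ supp I := hsupp ▸ Set.mem_univ _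
  rw [minGens, Set.mem_ofPred_eq] at hu
  have : u ≤ 0 := Minimal.le_of_le hu (y := 0) h1 zero_le
  exact hne (by simp [le_antisymm this zero_le])

lemma monoSpan_image_add (a : Fin n →₀ ℕ) (A : Set (Fin n →₀ ℕ)) :
    monoSpan K ((fun b => a + b) '' A) = Ideal.span {mono K a} * monoSpan K A := by
  rw [monoSpan, monoSpan, Ideal.span_mul_span', Set.singleton_mul, Set.image_image, Set.image_image]
  simp only [mono_add]

lemma prod_X_eq_mono :
    ∏ i : Fin n, (MvPolynomial.X i : S K n) = mono K (∑ i, Finsupp.single i 1) := by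
  rw [mono, MvPolynomial.monomial_sum_one]
  rfl

end Socle

end

end MonomialRes

theorem corollary3p2 {K : Type*} [Field K] (n : ℕ) (hn : 1 ≤ n)
    (I : Ideal (MonomialRes.S K n)) (hI : MonomialRes.IsMonomialIdeal I)
    (hsupp : MonomialRes.supp I = Set.univ)
    (d : ℕ) (hlin : MonomialRes.HasLinearResolution I d)
    (F : MonomialRes.MinimalResolution I) :
    F.HS (n - 1) =
      Ideal.span {∏ i : Fin n, (MvPolynomial.X i : MonomialRes.S K n)} * MonomialRes.soc d I := by
  have h1 := MonomialRes.one_notMem_of_supp hn hsupp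
  rw [MonomialRes.MinimalResolution.HS, F.range_shift_eq hn h1, MonomialRes.monoSpan_image_add,
    MonomialRes.soc_eq hn h1 hlin, MonomialRes.prod_X_eq_mono]
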